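/- Theorem 4. Consider stochastic bandits with $K\ge 2$ arms and horizon $T$. In each round $t$ a reward vector $(r_{t,k})_{k\in[K]}\in[0,1]^K$ is drawn i.i.d. from an unknown law with means $\mu_k$; an adversary, who knows the reward vectors up to round $t$ and the arms pulled before round $t$, replaces it by a corrupted vector $(\tilde r_{t,k})_k\in[0,1]^K$. The (possibly randomized) algorithm pulls an arm $I_t$ and is shown $\tilde r_{t,I_t}$ only after the batch containing round $t$ has ended, where the $L\ge 2$ batches are given by a static grid $0=t_0<t_1<\dots<t_L=T$, fixed in advance as part of the algorithm. The corruption level is $\sum_{t=1}^T\max_k|\tilde r_{t,k}-r_{t,k}|$, and the pseudo-regret is $R(T)=\mathbb{E}\big[\sum_{t=1}^T(\max_k\mu_k-\mu_{I_t})\big]$. There is an absolute constant $c>0$ such that the following holds for all integers $K\ge2$, $L\ge 2$, $T$ and all real $C\in[0,T]$ with $$K\le \max\big\{T^{\,1-(2-2^{1-L})/L},\ C^{\,1-1/L}\big\}$$ (which, for given $K$ and $L\ge2$, holds for all large $T$; $T\ge K^4$ suffices). For every algorithm with a static grid of $L$ batches there is an instance (reward law and adversary) with corruption level equal to $C$ almost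 surely, on which $$R(T)\ \ge\ c\,T^{1/L}\big(K+C^{1-1/L}\big).$$ -/

import Mathlib

open MeasureTheory

universe u

/-- A static grid `0 = t₀ < t₁ < ⋯ < t_L = T` splitting the horizon `T` into `L` batches.
The rounds are numbered `0, …, T - 1`; batch `j + 1` consists of the rounds `s` with
`t_j ≤ s < t_{j+1}`. -/
structure StaticGrid (T L : ℕ) where
  time : Fin (L + 1) → ℕ
  strictMono : StrictMono time
  time_zero : time 0 = 0
  time_last : time (Fin.last L) = T

/-- Some batch that contains or comes after round `s` has concluded before round `t`: the
feedback of round `s` is available in round `t`. -/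
def StaticGrid.Observed {T L : ℕ} (g : StaticGrid T L) (s t : Fin T) : Prop :=
  ∃ j, (s : ℕ) < g.time j ∧ g.time j ≤ (t : ℕ)

theorem StaticGrid.Observed.lt {T L : ℕ} {g : StaticGrid T L} {s t : Fin T}
    (h : g.Observed s t) : s < t := by
  obtain ⟨j, h₁, h₂⟩ := h
  exact Fin.lt_def.2 (lt_of_lt_of_le h₁ h₂)

/-- A (possibly randomized) batched bandit algorithm with `K` arms, horizon `T` and a static
grid of `L` batches. The internal randomness is a seed drawn from `seedLaw`. The arm of round `t`
is a function of the seed and of the pairs (pulled arm, observed reward) of the rounds whose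
batch has already concluded. -/
structure BatchedAlgorithm (K T L : ℕ) where
  grid : StaticGrid T L
  Seed : Type u
  seedSpace : MeasurableSpace Seed
  seedLaw : Measure Seed
  isProb : IsProbabilityMeasure seedLaw
  act : ∀ t : Fin T, Seed → ({s : Fin T // grid.Observed s t} → Fin K × unitInterval) → Fin K
  measurable_act : ∀ t, Measurable (Function.uncurry (act t))

attribute [instance] BatchedAlgorithm.seedSpace BatchedAlgorithm.isProb

/-- An instance of corrupted bandits with `K` arms and horizon `T`: the law `law` of the reward
vector in `[0,1]^K`, drawn independently in each round, and an adversary. In round `t` the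
adversary knows the reward vectors of the rounds `≤ t` and the arms pulled in the rounds `< t`,
and outputs the vector of corrupted rewards. -/
structure CorruptedInstance (K T : ℕ) where
  law : Measure (Fin K → unitInterval)
  isProb : IsProbabilityMeasure law
  corrupt : ∀ t : Fin T, ({s : Fin T // s ≤ t} → Fin K → unitInterval) →
    ({s : Fin T // s < t} → Fin K) → Fin K → unitInterval
  measurable_corrupt : ∀ t, Measurable (Function.uncurry (corrupt t))

attribute [instance] CorruptedInstance.isProb

noncomputable section

namespace CorruptedInstance

variable {K T : ℕ} (I : CorruptedInstance K T)

/-- The mean `μ_k` of the uncorrupted reward of arm `k`. -/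
def mean (k : Fin K) : ℝ := ∫ r, (r k : ℝ) ∂I.law

/-- The suboptimality gap `Δ_k = max_i μ_i - μ_k`. -/
def gap (k : Fin K) : ℝ := (⨆ i, I.mean i) - I.mean k

/-- The vector of corrupted rewards of round `t`, given the table `r` of reward vectors and the arms
`a` pulled before round `t`. -/
def corrupted (r : Fin T → Fin K → unitInterval) (t : Fin T) (a : {s : Fin T // s < t} → Fin K) :
    Fin K → unitInterval :=
  I.corrupt t (fun s => r s.1) a

end CorruptedInstance

namespace BatchedAlgorithm

variable {K T L : ℕ} (A : BatchedAlgorithm.{u} K T L) (I : CorruptedInstance K T)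

/-- The joint law of the seed and of the i.i.d. reward vectors of the `T` rounds. -/
def gameLaw : Measure (A.Seed × (Fin T → Fin K → unitInterval)) :=
  A.seedLaw.prod (Measure.pi fun _ => I.law)

/-- The arm `I_t` that the algorithm pulls in round `t`, as a function of the seed and of the
reward vectors. -/
def arm (z : A.Seed × (Fin T → Fin K → unitInterval)) (t : Fin T) : Fin K :=
  A.act t z.1 fun s =>
    (arm z s.1, I.corrupted z.2 s.1 (fun v => arm z v.1) (arm z s.1))
termination_by t
decreasing_by
  all_goals first
    | exact s.2.lt
    | exact lt_trans v.2 s.2.lt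

/-- The vector of corrupted rewards of round `t` in the game. -/
def corruptedReward (z : A.Seed × (Fin T → Fin K → unitInterval)) (t : Fin T) :
    Fin K → unitInterval :=
  I.corrupted z.2 t fun s => A.arm I z s.1

/-- The corruption level `∑_t max_k |r̃_{t,k} - r_{t,k}|` of a run of the game. -/
def corruptionLevel (z : A.Seed × (Fin T → Fin K → unitInterval)) : ℝ :=
  ∑ t, ⨆ k, |(A.corruptedReward I z t k : ℝ) - (z.2 t k : ℝ)|

/-- The pseudo-regret `𝔼[∑_t Δ_{I_t}]`, measured with the uncorrupted means. -/
def regret : ℝ := ∫ z, ∑ t, I.gap (A.arm I z t) ∂(A.gameLaw I)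

end BatchedAlgorithm

end

/-! Up to time `t_{j+1}` the arms depend only on feedback from before `t_j`. If that feedback barely
identifies the good arm among `K` candidates, averaging over its position gives regret of order `Δ
t_{j+1}` (`exists_regret_ge`). Two constructions exploit this; the larger of `K` and `C^(1-1/L)`
decides which one is used.

Corruption: with deterministic rewards and gap `Δ = C / max t_j C`, the adversary can afford to make
all arms look identical until `t_j`. Some batch satisfies `t_{j+1} ≥ (T/C)^(1/L) max t_j C`, since
otherwise the grid would end before `T`; the regret is then of order `C (T/C)^(1/L)`.

Arms: with Bernoulli rewards and gap `Δ` of order `√(K / max t_j K)`, the first `t_j` rounds carry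
total divergence of order `Δ² t_j ≤ K`. This is shared among `K` candidates, so a typical one stays
undetected (`sum_likelihood_le`). The matching growth step is `t_{j+1} ≥ K T^(1/L) √(max t_j K /
K)`; the adversary only spends its budget, by an uninformative blur. -/

/-- The rounds up to the end of batch `j + 1` only use feedback of the first `j` batches. -/
theorem StaticGrid.Observed.lt_time {T L : ℕ} {g : StaticGrid T L} {s t : Fin T}
    (h : g.Observed s t) (j : Fin L) (ht : (t : ℕ) < g.time j.succ) :
    (s : ℕ) < g.time j.castSucc := by
  obtain ⟨i, h₁, h₂⟩ := h
  have hi : i < j.succ := g.strictMono.lt_iff_lt.1 (lt_of_le_of_lt h₂ ht)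
  exact lt_of_lt_of_le h₁ (g.strictMono.monotone (Fin.le_castSucc_iff.2 hi))

/-! ### Replay on prescribed feedback, measurability and the regret as a sum -/

namespace BatchedAlgorithm

variable {K T L : ℕ} (A : BatchedAlgorithm.{u} K T L) (I : CorruptedInstance K T)

/-- The arms pulled by the algorithm with a given seed when it observes the rewards `o`, whatever
arms it pulls. -/
noncomputable def play (o : Fin T → unitInterval) (w : A.Seed) (t : Fin T) : Fin K :=
  A.act t w fun s => (play o w s.1, o s.1)
termination_by t
decreasing_by exact s.2.lt

theorem measurable_play (o : Fin T → unitInterval) (t : Fin T) :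
    Measurable fun w => A.play o w t := by
  induction t using WellFoundedLT.induction with
  | ind t ih =>
    have h : (fun w => A.play o w t) = fun w => Function.uncurry (A.act t)
        (w, fun s => (A.play o w s.1, o s.1)) := by
      funext w; rw [play]; rfl
    rw [h]
    refine (A.measurable_act t).comp (measurable_id.prodMk (measurable_pi_lambda _ fun s => ?_))
    exact (ih s.1 s.2.lt).prodMk measurable_const

theorem measurable_arm (t : Fin T) : Measurable fun z => A.arm I z t := by
  induction t using WellFoundedLT.induction with
  | ind t ih =>
    have h : (fun z => A.arm I z t) = fun z => Function.uncurry (A.act t)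
        (z.1, fun s => (A.arm I z s.1,
          I.corrupted z.2 s.1 (fun v => A.arm I z v.1) (A.arm I z s.1))) := by
      funext z; rw [arm]; rfl
    rw [h]
    refine (A.measurable_act t).comp (measurable_fst.prodMk (measurable_pi_lambda _ fun s => ?_))
    refine (ih s.1 s.2.lt).prodMk ?_
    have hc : Measurable fun z : A.Seed × (Fin T → Fin K → unitInterval) =>
        I.corrupted z.2 s.1 (fun v => A.arm I z v.1) := by
      have := (I.measurable_corrupt s.1).comp
        ((measurable_pi_lambda (fun (z : A.Seed × (Fin T → Fin K → unitInterval))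
          (v : {v : Fin T // v ≤ s.1}) => z.2 v.1)
          fun v => (measurable_pi_apply v.1).comp measurable_snd).prodMk
        (measurable_pi_lambda (fun (z : A.Seed × (Fin T → Fin K → unitInterval))
          (v : {v : Fin T // v < s.1}) => A.arm I z v.1)
          fun v => ih v.1 (lt_trans v.2 s.2.lt)))
      exact this
    -- Evaluating a random vector at a random arm is jointly measurable because there are countably
    -- many arms.
    exact (measurable_from_prod_countable_left
      (f := fun p : (Fin K → unitInterval) × Fin K => p.1 p.2)
      fun k => measurable_pi_apply k).comp (hc.prodMk (ih s.1 s.2.lt))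

/-- If the algorithm sees the rewards `o` in the first `j` batches, then it pulls the arms of
`play o` up to the end of batch `j + 1`. -/
theorem arm_eq_play (j : Fin L) (o : Fin T → unitInterval) (w : A.Seed)
    (r : Fin T → Fin K → unitInterval)
    (h : ∀ s : Fin T, (s : ℕ) < A.grid.time j.castSucc →
      ∀ a, I.corrupted r s a (A.play o w s) = o s)
    (t : Fin T) (ht : (t : ℕ) < A.grid.time j.succ) : A.arm I (w, r) t = A.play o w t := by
  induction t using WellFoundedLT.induction with
  | ind t ih =>
    rw [arm, play]
    congr 1
    funext s
    have e := ih s.1 s.2.lt (lt_trans (Fin.lt_def.1 s.2.lt) ht)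
    rw [e, h s.1 (s.2.lt_time j ht)]

/-- The arms of `play` up to a round depend only on the rewards observed before that round. -/
theorem play_congr {o o' : Fin T → unitInterval} (w : A.Seed) (t : Fin T)
    (h : ∀ s < t, o s = o' s) : A.play o w t = A.play o' w t := by
  induction t using WellFoundedLT.induction with
  | ind t ih =>
    rw [play, play]
    congr 1
    funext s
    rw [ih s.1 s.2.lt fun v hv => h v (lt_trans hv s.2.lt), h s.1 s.2.lt]

instance : IsProbabilityMeasure (A.gameLaw I) := by unfold gameLaw; infer_instance

theorem ae_gameLaw {p : (Fin K → unitInterval) → Prop} (h : ∀ᵐ x ∂I.law, p x) :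
    ∀ᵐ z ∂(A.gameLaw I), ∀ t, p (z.2 t) := by
  rw [ae_all_iff]
  intro t
  have h₁ : ∀ᵐ r ∂(Measure.pi fun _ : Fin T => I.law), p (r t) :=
    (measurePreserving_eval (fun _ : Fin T => I.law) t).quasiMeasurePreserving.ae h
  exact Measure.quasiMeasurePreserving_snd.ae h₁

theorem integrable_comp_arm (f : Fin K → ℝ) (t : Fin T) :
    Integrable (fun z => f (A.arm I z t)) (A.gameLaw I) := by
  refine Integrable.of_bound
    ((measurable_of_finite f).comp (A.measurable_arm I t)).aestronglyMeasurable
    (∑ k, ‖f k‖) (Filter.Eventually.of_forall fun z => ?_)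
  exact Finset.single_le_sum (f := fun k => ‖f k‖) (fun k _ => norm_nonneg _) (Finset.mem_univ _)

theorem regret_eq_sum : A.regret I = ∑ t, ∫ z, I.gap (A.arm I z t) ∂(A.gameLaw I) :=
  integral_finsetSum _ fun t _ => A.integrable_comp_arm I I.gap t

end BatchedAlgorithm

/-! ### Regret averaged over the position of the good arm -/

/-- The gaps of an instance all of whose arms but `i` have the same mean. -/
theorem CorruptedInstance.gap_of_mean {K T : ℕ} (I : CorruptedInstance K T) (i : Fin K) {m Δ : ℝ}
    (hΔ : 0 ≤ Δ) (h : ∀ k, I.mean k = if k = i then m + Δ else m) (k : Fin K) :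
    I.gap k = if k = i then 0 else Δ := by
  have hsup : ⨆ k, I.mean k = m + Δ := by
    have : Nonempty (Fin K) := ⟨i⟩
    refine le_antisymm (ciSup_le fun k => ?_) ?_
    · rw [h]; split_ifs <;> linarith
    · have := le_ciSup (Set.finite_range I.mean).bddAbove i
      rwa [h i, if_pos rfl] at this
  rw [gap, hsup, h]
  split_ifs <;> ring

namespace BatchedAlgorithm

variable {K T L : ℕ} (A : BatchedAlgorithm.{u} K T L)

/-- In a family of instances in which arm `i` of instance `i` beats all others by `Δ`, some
instance has large regret if in the first `n` rounds the arm `i` is seldom pulled on average. -/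
theorem exists_regret_ge (hK : 0 < K) (I : Fin K → CorruptedInstance K T) {Δ δ : ℝ}
    (hΔ : 0 ≤ Δ) (hgap : ∀ i k, (I i).gap k = if k = i then 0 else Δ) {n : ℕ} (hn : n ≤ T)
    (h : ∀ t : Fin T, (t : ℕ) < n →
      ∑ i, (A.gameLaw (I i)).real {z | A.arm (I i) z t = i} ≤ (1 - δ) * K) :
    ∃ i, δ * (Δ * n) ≤ A.regret (I i) := by
  have hint : ∀ i t, ∫ z, (I i).gap (A.arm (I i) z t) ∂(A.gameLaw (I i)) =
      Δ * (1 - (A.gameLaw (I i)).real {z | A.arm (I i) z t = i}) := by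
    intro i t
    have hm : MeasurableSet {z | A.arm (I i) z t = i} :=
      A.measurable_arm (I i) t (measurableSet_singleton i)
    rw [← probReal_compl_eq_one_sub hm, ← integral_indicator_one hm.compl, ← integral_const_mul]
    congr 1
    funext z
    rw [hgap]
    by_cases hz : A.arm (I i) z t = i <;> simp [hz, Set.indicator]
  have hcard : ((Finset.univ.filter fun t : Fin T => (t : ℕ) < n).card : ℝ) = n := by
    rw [Fin.card_filter_val_lt, min_eq_right hn]
  have hsum : K * (δ * (Δ * n)) ≤ ∑ i, A.regret (I i) := by
    calc K * (δ * (Δ * n))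
        = ∑ t ∈ Finset.univ.filter fun t : Fin T => (t : ℕ) < n, Δ * (δ * K) := by
          rw [Finset.sum_const, nsmul_eq_mul, hcard]; ring
      _ ≤ ∑ t ∈ Finset.univ.filter fun t : Fin T => (t : ℕ) < n,
            Δ * ∑ i, (1 - (A.gameLaw (I i)).real {z | A.arm (I i) z t = i}) := by
          refine Finset.sum_le_sum fun t ht => mul_le_mul_of_nonneg_left ?_ hΔ
          have := h t (Finset.mem_filter.1 ht).2
          rw [Finset.sum_sub_distrib]
          simp only [Finset.sum_const, Finset.card_univ, Fintype.card_fin, nsmul_eq_mul, mul_one]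
          linarith
      _ ≤ ∑ t : Fin T, Δ * ∑ i, (1 - (A.gameLaw (I i)).real {z | A.arm (I i) z t = i}) := by
          refine Finset.sum_le_sum_of_subset_of_nonneg (Finset.filter_subset _ _) fun t _ _ => ?_
          exact mul_nonneg hΔ (Finset.sum_nonneg fun i _ => sub_nonneg.2 measureReal_le_one)
      _ = ∑ i, A.regret (I i) := by
          simp only [regret_eq_sum, hint, Finset.mul_sum]
          exact Finset.sum_comm
  by_contra! hlt
  have : Nonempty (Fin K) := ⟨⟨0, hK⟩⟩
  have := Finset.sum_lt_sum_of_nonempty Finset.univ_nonempty fun i _ => hlt i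
  simp only [Finset.sum_const, Finset.card_univ, Fintype.card_fin, nsmul_eq_mul] at this
  linarith

end BatchedAlgorithm

/-! ### The hidden arm: hardness from corruption -/

/-- Arm `i` has the deterministic reward `Δ`, the other arms have reward `0`. In the rounds before
`τ` the adversary hides arm `i` by showing the reward `Δ` for all arms, later it shows `v` for
the arms other than `i`. -/
noncomputable def hiddenArm {K : ℕ} (T : ℕ) (i : Fin K) (τ : ℕ) (Δ v : unitInterval) :
    CorruptedInstance K T where
  law := Measure.dirac fun k => if k = i then Δ else 0
  isProb := inferInstance
  corrupt t _ _ k := if (t : ℕ) < τ then Δ else if k = i then Δ else v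
  measurable_corrupt _ := measurable_const

theorem hiddenArm_gap {K T : ℕ} (i : Fin K) (τ : ℕ) (Δ v : unitInterval) (k : Fin K) :
    (hiddenArm T i τ Δ v).gap k = if k = i then 0 else (Δ : ℝ) := by
  refine CorruptedInstance.gap_of_mean _ i (m := 0) Δ.2.1 (fun k => ?_) k
  simp only [CorruptedInstance.mean, hiddenArm]
  rw [integral_dirac]
  split_ifs with h <;> simp [h]

theorem Fin.exists_ne_of_two_le {K : ℕ} (hK : 2 ≤ K) (i : Fin K) : ∃ k, k ≠ i := by
  have : Nontrivial (Fin K) := Fin.nontrivial_iff_two_le.2 hK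
  exact exists_ne i

theorem Fin.sum_ite_val_lt {T τ : ℕ} (hτ : τ ≤ T) (a b : ℝ) :
    (∑ t : Fin T, if (t : ℕ) < τ then a else b) = τ * a + (T - τ) * b := by
  have h := fun t : Fin T => show (if (t : ℕ) < τ then a else b) =
    (if (t : ℕ) < τ then a - b else 0) + b by split_ifs <;> ring
  rw [Finset.sum_congr rfl fun t _ => h t, Finset.sum_add_distrib, ← Finset.sum_filter,
    Finset.sum_const, Fin.card_filter_val_lt, min_eq_right hτ, Finset.sum_const,
    Finset.card_univ, Fintype.card_fin, nsmul_eq_mul, nsmul_eq_mul]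
  ring

namespace BatchedAlgorithm

variable {K T L : ℕ} (A : BatchedAlgorithm.{u} K T L)

theorem hiddenArm_corruptionLevel (hK : 2 ≤ K) (i : Fin K) {τ : ℕ} (hτ : τ ≤ T)
    (Δ v : unitInterval) :
    ∀ᵐ z ∂(A.gameLaw (hiddenArm T i τ Δ v)),
      A.corruptionLevel (hiddenArm T i τ Δ v) z = τ * Δ + (T - τ) * v := by
  have h : ∀ᵐ x ∂(hiddenArm T i τ Δ v).law, x = fun k => if k = i then Δ else 0 := by
    simp only [hiddenArm]
    rw [ae_dirac_eq]
    rfl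
  filter_upwards [A.ae_gameLaw _ h] with z hz
  rw [corruptionLevel, ← Fin.sum_ite_val_lt hτ]
  refine Finset.sum_congr rfl fun t _ => ?_
  -- Arm `i` itself is never corrupted, so the maximum is attained at any other arm; this needs a
  -- second arm.
  obtain ⟨k₀, hk₀⟩ := Fin.exists_ne_of_two_le hK i
  have : Nonempty (Fin K) := ⟨i⟩
  have hΔ := Δ.2.1
  have hv := v.2.1
  have e : ∀ k, |(A.corruptedReward (hiddenArm T i τ Δ v) z t k : ℝ) - (z.2 t k : ℝ)| =
      if k = i then 0 else if (t : ℕ) < τ then (Δ : ℝ) else v := by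
    intro k
    rw [hz]
    simp only [corruptedReward, CorruptedInstance.corrupted, hiddenArm]
    split_ifs <;> simp [abs_of_nonneg, hΔ, hv]
  refine le_antisymm (ciSup_le fun k => ?_) ?_
  · rw [e]; split_ifs <;> simp [hΔ, hv]
  · have := le_ciSup (f := fun k => |(A.corruptedReward (hiddenArm T i τ Δ v) z t k : ℝ) -
      (z.2 t k : ℝ)|) (Set.finite_range _).bddAbove k₀
    rwa [e, if_neg hk₀] at this

/-- The feedback read before `t_{j+1}` is constantly `Δ`, so the law of the arm pulled does not
depend on `i`. The probabilities of pulling the good arm then sum over `i` to at most `1 ≤ K / 2`.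
-/
theorem exists_hiddenArm_regret (hK : 2 ≤ K) (j : Fin L) (Δ v : unitInterval) :
    ∃ i, 1 / 2 * ((Δ : ℝ) * A.grid.time j.succ) ≤
      A.regret (hiddenArm T i (A.grid.time j.castSucc) Δ v) := by
  have hn : A.grid.time j.succ ≤ T := by
    conv_rhs => rw [← A.grid.time_last]
    exact A.grid.strictMono.monotone (Fin.le_last _)
  refine A.exists_regret_ge (by lia) _ Δ.2.1 (fun i k => hiddenArm_gap i _ Δ v k) hn
    fun t ht => ?_
  have e : ∀ i, (A.gameLaw (hiddenArm T i (A.grid.time j.castSucc) Δ v)).real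
      {z | A.arm (hiddenArm T i (A.grid.time j.castSucc) Δ v) z t = i} =
      A.seedLaw.real ((fun w => A.play (fun _ => Δ) w t) ⁻¹' {i}) := by
    intro i
    have hm : MeasurableSet ((fun w => A.play (fun _ => Δ) w t) ⁻¹' {i}) :=
      A.measurable_play _ t (measurableSet_singleton i)
    have hp : MeasurePreserving Prod.fst
        (A.gameLaw (hiddenArm T i (A.grid.time j.castSucc) Δ v)) A.seedLaw :=
      measurePreserving_fst
    rw [← hp.measureReal_preimage hm.nullMeasurableSet]
    congr 1
    ext z
    have := A.arm_eq_play (hiddenArm T i (A.grid.time j.castSucc) Δ v) j (fun _ => Δ) z.1 z.2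
      (fun s hs a => if_pos hs) t ht
    simp [this]
  simp only [e]
  rw [sum_measureReal_preimage_singleton _
    fun i _ => A.measurable_play _ t (measurableSet_singleton i)]
  have : (2 : ℝ) ≤ K := by exact_mod_cast hK
  have h1 : A.seedLaw.real ((fun w => A.play (fun _ => Δ) w t) ⁻¹' ↑(Finset.univ : Finset (Fin K)))
    ≤ 1 := measureReal_le_one
  linarith

end BatchedAlgorithm

/-! ### Likelihood ratios and divergence -/

/-- A pointwise substitute for Pinsker's inequality. With `s = √x`, `x - 1 - log x ≥ (s - 1)²`, and
AM-GM bounds `x - 1 = (s - 1)(s + 1)` by `8(s - 1)² + (s + 1)²/32`, where `(s + 1)² ≤ 2(x + 1)`. -/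
theorem le_one_add_sub_log_add {x : ℝ} (hx : 0 < x) :
    x ≤ 1 + 8 * (x - 1 - Real.log x) + (x + 1) / 16 := by
  have h₁ : Real.log x = 2 * Real.log √x := by
    rw [Real.log_sqrt hx.le]; ring
  have h₂ := Real.log_le_sub_one_of_pos (Real.sqrt_pos.2 hx)
  have h₃ : x = √x ^ 2 := (Real.sq_sqrt hx.le).symm
  nlinarith [sq_nonneg (16 * (√x - 1) - (√x + 1)), sq_nonneg (√x - 1)]

theorem neg_log_one_sub_sq_le {ε : ℝ} (hε : ε ^ 2 ≤ 1 / 2) :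
    -Real.log (1 - ε ^ 2) ≤ 2 * ε ^ 2 := by
  have hpos : 0 < 1 - ε ^ 2 := by linarith
  have h := Real.one_sub_inv_le_log_of_pos hpos
  have : (1 - ε ^ 2)⁻¹ ≤ 1 + 2 * ε ^ 2 := by
    rw [inv_le_iff_one_le_mul₀ hpos]
    nlinarith [sq_nonneg ε]
  linarith

/-- The sign of a reward bit. -/
def bitSign (b : Bool) : ℝ := if b then 1 else -1

section Likelihood

variable {W : Type*} [Fintype W] [DecidableEq W] {K : ℕ}

/-- The likelihood ratio of the reward bits `y`, if arm `J y s` is pulled in round `s` and arm `i`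
has bias `ε`, with respect to unbiased arms. -/
def likelihood (J : (W → Bool) → W → Fin K) (ε : ℝ) (i : Fin K) (y : W → Bool) : ℝ :=
  ∏ s, (1 + if J y s = i then ε * bitSign (y s) else 0)

theorem likelihood_factor_pos {ε : ℝ} (hε : ε ^ 2 ≤ 1 / 2) (p : Prop) [Decidable p] (b : Bool) :
    0 < 1 + if p then ε * bitSign b else 0 := by
  have h : |ε| < 1 := by
    rw [← sq_lt_one_iff_abs_lt_one]; linarith
  have := abs_lt.1 h
  unfold bitSign
  split_ifs <;> linarith

/-- Flipping bit `s` keeps the arm and changes the sign. Each pair of such outcomes with arm `i`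
contributes `-log (1 - ε²) ≤ 2ε²`: the first-order terms cancel. -/
theorem sum_neg_log_factor_le (J : (W → Bool) → W → Fin K)
    (hJ : ∀ y s b, J (Function.update y s b) s = J y s) {ε : ℝ} (hε : ε ^ 2 ≤ 1 / 2)
    (i : Fin K) (s : W) :
    ∑ y, -Real.log (1 + if J y s = i then ε * bitSign (y s) else 0) ≤
      ∑ y, if J y s = i then ε ^ 2 else 0 := by
  have hinv : Function.Involutive fun y : W → Bool => Function.update y s (!y s) := by
    intro y; simp
  have hflip := Equiv.sum_comp (Function.Involutive.toPerm _ hinv)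
    fun y => -Real.log (1 + if J y s = i then ε * bitSign (y s) else 0)
  have hadd : ∑ y, (-Real.log (1 + if J y s = i then ε * bitSign (y s) else 0) +
      -Real.log (1 + if J (Function.Involutive.toPerm _ hinv y) s = i then
        ε * bitSign (Function.Involutive.toPerm _ hinv y s) else 0)) ≤
      ∑ y, 2 * if J y s = i then ε ^ 2 else 0 := by
    refine Finset.sum_le_sum fun y _ => ?_
    simp only [Function.Involutive.coe_toPerm, hJ, Function.update_self]
    have h₁ := likelihood_factor_pos hε True true
    have h₂ := likelihood_factor_pos hε True false
    simp only [bitSign, if_true, Bool.false_eq_true, if_false] at h₁ h₂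
    have h₃ := neg_log_one_sub_sq_le hε
    have h₄ : Real.log (1 - ε ^ 2) = Real.log (1 + ε * 1) + Real.log (1 + ε * -1) := by
      rw [← Real.log_mul h₁.ne' h₂.ne']; congr 1; ring
    split_ifs with h
    · cases y s <;> simp only [bitSign, Bool.not_true, Bool.not_false, if_true,
        Bool.false_eq_true, if_false] <;> linarith
    · simp
  rw [Finset.sum_add_distrib, hflip, ← Finset.mul_sum] at hadd
  linarith

/-- A round pulls a single arm, so the divergences from unbiased bits, summed over all `i`, cost
`ε²` per round rather than `K ε²`. The bound `hM` is assumed because `hJ` does not forbid dependence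
on later bits and so does not force total mass `1`. -/
theorem sum_likelihood_le (J : (W → Bool) → W → Fin K)
    (hJ : ∀ y s b, J (Function.update y s b) s = J y s) (D : (W → Bool) → Fin K) {ε : ℝ}
    (hε : ε ^ 2 ≤ 1 / 2)
    (hM : ∀ i, ∑ y, (1 / 2 : ℝ) ^ Fintype.card W * likelihood J ε i y ≤ 1) :
    ∑ i, ∑ y, (if D y = i then (1 / 2 : ℝ) ^ Fintype.card W * likelihood J ε i y else 0) ≤
      1 + 8 * (ε ^ 2 * Fintype.card W) + K / 8 := by
  set p : ℝ := (1 / 2 : ℝ) ^ Fintype.card W with hp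
  have hp0 : 0 ≤ p := by positivity
  have hp1 : ∑ _y : W → Bool, p = 1 := by
    simp [hp, Finset.sum_const]
  have hlog : ∀ i y, -Real.log (likelihood J ε i y) =
      ∑ s, -Real.log (1 + if J y s = i then ε * bitSign (y s) else 0) := by
    intro i y
    rw [likelihood, Real.log_prod fun s _ => (likelihood_factor_pos hε _ _).ne',
      Finset.sum_neg_distrib]
  have hKL : ∑ i, ∑ y, p * -Real.log (likelihood J ε i y) ≤ ε ^ 2 * Fintype.card W := by
    calc ∑ i, ∑ y, p * -Real.log (likelihood J ε i y)
        = ∑ i, p * ∑ s, ∑ y, -Real.log (1 + if J y s = i then ε * bitSign (y s) else 0) := by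
          refine Finset.sum_congr rfl fun i _ => ?_
          rw [← Finset.mul_sum, Finset.sum_comm]
          simp only [hlog]
      _ ≤ ∑ i, p * ∑ s, ∑ y, if J y s = i then ε ^ 2 else 0 := by
          refine Finset.sum_le_sum fun i _ => mul_le_mul_of_nonneg_left ?_ hp0
          exact Finset.sum_le_sum fun s _ => sum_neg_log_factor_le J hJ hε i s
      _ = ∑ s : W, ∑ y : W → Bool, p * ε ^ 2 := by
          rw [← Finset.mul_sum, Finset.sum_comm, Finset.mul_sum]
          refine Finset.sum_congr rfl fun s _ => ?_
          rw [Finset.sum_comm, Finset.mul_sum]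
          simp
      _ = ε ^ 2 * Fintype.card W := by
          simp only [← Finset.sum_mul, hp1]
          simp [mul_comm]
  -- Where `D y ≠ i` the left side vanishes and the right side is nonnegative, so the correction
  -- terms can be summed over all `y`.
  have hpt : ∀ i y, (if D y = i then p * likelihood J ε i y else 0) ≤
      (if D y = i then p else 0) + 8 * (p * likelihood J ε i y - p +
        p * -Real.log (likelihood J ε i y)) + (p * likelihood J ε i y + p) / 16 := by
    intro i y
    have hpos : 0 < likelihood J ε i y :=
      Finset.prod_pos fun s _ => likelihood_factor_pos hε _ _
    have h₁ := mul_le_mul_of_nonneg_left (le_one_add_sub_log_add hpos) hp0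
    have h₂ := mul_nonneg hp0 (sub_nonneg.2 (Real.log_le_sub_one_of_pos hpos))
    have h₃ := mul_nonneg hp0 hpos.le
    split_ifs <;> linarith
  calc ∑ i, ∑ y, (if D y = i then p * likelihood J ε i y else 0)
      ≤ ∑ i, ∑ y, ((if D y = i then p else 0) + 8 * (p * likelihood J ε i y - p +
        p * -Real.log (likelihood J ε i y)) + (p * likelihood J ε i y + p) / 16) :=
        Finset.sum_le_sum fun i _ => Finset.sum_le_sum fun y _ => hpt i y
    _ = 1 + ∑ i, (8 * (∑ y, p * likelihood J ε i y - 1) +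
          (∑ y, p * likelihood J ε i y + 1) / 16) +
          8 * ∑ i, ∑ y, p * -Real.log (likelihood J ε i y) := by
        have hD : ∑ i, ∑ y, (if D y = i then p else 0) = 1 := by
          rw [Finset.sum_comm]; simpa using hp1
        simp only [Finset.sum_add_distrib, Finset.sum_sub_distrib, ← Finset.mul_sum,
          ← Finset.sum_div, hp1] at hD ⊢
        rw [hD]
        ring
    _ ≤ 1 + ∑ i : Fin K, (1 / 8 : ℝ) + 8 * (ε ^ 2 * Fintype.card W) := by
        gcongr with i
        linarith [hM i]
    _ = 1 + 8 * (ε ^ 2 * Fintype.card W) + K / 8 := by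
        simp; ring

end Likelihood

/-! ### Blurred Bernoulli rewards: hardness from many arms -/

/-- The Bernoulli law with mean `p`. -/
noncomputable def coin (p : unitInterval) : Measure unitInterval :=
  ENNReal.ofReal p • Measure.dirac 1 + ENNReal.ofReal (1 - p) • Measure.dirac 0

/-- The reward of a bit. -/
def bitReward (b : Bool) : unitInterval := if b then 1 else 0

theorem bitReward_injective : Function.Injective bitReward := by
  intro a b h
  cases a <;> cases b <;> simp_all [bitReward]

instance (p : unitInterval) : IsProbabilityMeasure (coin p) := by
  refine ⟨?_⟩
  have h := p.2
  simp only [coin, Measure.add_apply, Measure.smul_apply, measure_univ, smul_eq_mul, mul_one]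
  rw [← ENNReal.ofReal_add h.1 (by linarith [h.2])]
  simp

theorem coin_real_bitReward (p : unitInterval) (b : Bool) :
    (coin p).real {bitReward b} = if b then (p : ℝ) else 1 - p := by
  have h := p.2
  cases b <;> simp [coin, bitReward, measureReal_def, h.1, h.2]

theorem integral_coin (p : unitInterval) : ∫ x, (x : ℝ) ∂(coin p) = p := by
  have h := p.2
  rw [coin, integral_add_measure, integral_smul_measure, integral_smul_measure, integral_dirac,
    integral_dirac]
  · simp [h.1]
  · exact (integrable_dirac (by simp)).smul_measure (by simp)
  · exact (integrable_dirac (by simp)).smul_measure (by simp)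

theorem ae_coin (p : unitInterval) : ∀ᵐ x ∂(coin p), ∃ b, x = bitReward b := by
  rw [coin, ae_add_measure_iff]
  constructor
  · refine Measure.ae_smul_measure ?_ _
    rw [ae_dirac_eq]
    exact ⟨true, rfl⟩
  · refine Measure.ae_smul_measure ?_ _
    rw [ae_dirac_eq]
    exact ⟨false, rfl⟩

/-- The reward `x` moved towards `1 - x`. -/
noncomputable def blur (v x : unitInterval) : unitInterval :=
  ⟨(1 - v) * x + v * (1 - x), by
    have hv := v.2
    have hx := x.2
    have h₁ := mul_nonneg (sub_nonneg.2 hv.2) hx.1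
    have h₂ := mul_nonneg hv.1 (sub_nonneg.2 hx.2)
    have h₃ := mul_nonneg (sub_nonneg.2 hv.2) (sub_nonneg.2 hx.2)
    have h₄ := mul_nonneg hv.1 hx.1
    constructor <;> nlinarith⟩

/-- Both bit values move by the same amount, which makes the corruption level deterministic. -/
theorem abs_blur_bitReward_sub (v : unitInterval) (b : Bool) :
    |(blur v (bitReward b) : ℝ) - bitReward b| = v := by
  have hv := v.2.1
  cases b <;> simp [blur, bitReward, abs_of_nonneg hv]

theorem measurable_blur (v : unitInterval) : Measurable (blur v) := by
  unfold blur
  fun_prop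

/-- Independent Bernoulli rewards with means `p`, and an adversary that blurs all rewards. -/
noncomputable def blurredCoins {K : ℕ} (T : ℕ) (p : Fin K → unitInterval) (v : unitInterval) :
    CorruptedInstance K T where
  law := Measure.pi fun k => coin (p k)
  isProb := inferInstance
  corrupt t r _ k := blur v (r ⟨t, le_rfl⟩ k)
  measurable_corrupt t := by
    refine measurable_pi_lambda _ fun k => (measurable_blur v).comp ?_
    exact (measurable_pi_apply k).comp ((measurable_pi_apply _).comp measurable_fst)

section blurredCoins

variable {K T : ℕ} (p : Fin K → unitInterval) (v : unitInterval)

theorem blurredCoins_mean (k : Fin K) : (blurredCoins T p v).mean k = p k := by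
  rw [← integral_coin (p k)]
  exact integral_comp_eval (μ := fun k => coin (p k)) (f := fun x : unitInterval => (x : ℝ))
    (measurable_subtype_coe.aestronglyMeasurable)

theorem blurredCoins_law_real (k : Fin K) (b : Bool) :
    (blurredCoins T p v).law.real {x | x k = bitReward b} =
      if b then (p k : ℝ) else 1 - p k := by
  rw [← coin_real_bitReward]
  exact (measurePreserving_eval (fun k => coin (p k)) k).measureReal_preimage
    (measurableSet_singleton _).nullMeasurableSet

theorem ae_blurredCoins : ∀ᵐ x ∂(blurredCoins T p v).law, ∀ k, ∃ b, x k = bitReward b := by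
  rw [ae_all_iff]
  intro k
  exact (measurePreserving_eval (fun k => coin (p k)) k).quasiMeasurePreserving.ae (ae_coin (p k))

end blurredCoins

namespace BatchedAlgorithm

variable {K T L : ℕ} (A : BatchedAlgorithm.{u} K T L)

theorem blurredCoins_corruptionLevel (hK : 0 < K) (p : Fin K → unitInterval) (v : unitInterval) :
    ∀ᵐ z ∂(A.gameLaw (blurredCoins T p v)), A.corruptionLevel (blurredCoins T p v) z = T * v := by
  filter_upwards [A.ae_gameLaw _ (ae_blurredCoins p v)] with z hz
  have : Nonempty (Fin K) := ⟨⟨0, hK⟩⟩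
  have e : ∀ t k, |(A.corruptedReward (blurredCoins T p v) z t k : ℝ) - (z.2 t k : ℝ)| = v := by
    intro t k
    obtain ⟨b, hb⟩ := hz t k
    simp only [corruptedReward, CorruptedInstance.corrupted, blurredCoins, hb]
    exact abs_blur_bitReward_sub v b
  simp [corruptionLevel, e]

/-- The rewards that the algorithm observes if the reward bits before round `τ` are `y`. -/
noncomputable def bitFeedback {τ : ℕ} (v : unitInterval) (y : {s : Fin T // (s : ℕ) < τ} → Bool)
    (s : Fin T) : unitInterval :=
  if h : (s : ℕ) < τ then blur v (bitReward (y ⟨s, h⟩)) else 0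

/-- The reward tables for which the algorithm with seed `w` collects the reward bits `y` before
round `τ`. -/
def bitCylinder {τ : ℕ} (v : unitInterval) (w : A.Seed) (y : {s : Fin T // (s : ℕ) < τ} → Bool) :
    Set (Fin T → Fin K → unitInterval) :=
  {r | ∀ s : {s : Fin T // (s : ℕ) < τ}, r s.1 (A.play (bitFeedback v y) w s.1) = bitReward (y s)}

theorem measurableSet_bitCylinder {τ : ℕ} (v : unitInterval) (w : A.Seed)
    (y : {s : Fin T // (s : ℕ) < τ} → Bool) : MeasurableSet (A.bitCylinder v w y) := by
  rw [bitCylinder, Set.ofPred_forall]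
  exact MeasurableSet.iInter fun s => ((measurable_pi_apply _).comp (measurable_pi_apply s.1))
    (measurableSet_singleton _)

/-- Membership fixes all feedback available before `t_{j+1}`; the default value of `bitFeedback`
from `t_j` on is not read there. -/
theorem arm_eq_play_of_mem_bitCylinder (j : Fin L) (p : Fin K → unitInterval) (v : unitInterval)
    (w : A.Seed) (y : {s : Fin T // (s : ℕ) < A.grid.time j.castSucc} → Bool)
    {r : Fin T → Fin K → unitInterval} (hr : r ∈ A.bitCylinder v w y) (t : Fin T)
    (ht : (t : ℕ) < A.grid.time j.succ) :
    A.arm (blurredCoins T p v) (w, r) t = A.play (bitFeedback v y) w t := by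
  refine A.arm_eq_play _ j _ w r (fun s hs a => ?_) t ht
  have := hr ⟨s, hs⟩
  simp only [CorruptedInstance.corrupted, blurredCoins, bitFeedback, dif_pos hs] at this ⊢
  rw [this]

theorem eq_of_mem_bitCylinder (j : Fin L) (p : Fin K → unitInterval) (v : unitInterval)
    (w : A.Seed) {y : {s : Fin T // (s : ℕ) < A.grid.time j.castSucc} → Bool}
    {r : Fin T → Fin K → unitInterval} (hr : r ∈ A.bitCylinder v w y)
    (s : {s : Fin T // (s : ℕ) < A.grid.time j.castSucc}) :
    r s.1 (A.arm (blurredCoins T p v) (w, r) s.1) = bitReward (y s) := by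
  rw [A.arm_eq_play_of_mem_bitCylinder j p v w y hr s.1
    (lt_trans s.2 (A.grid.strictMono j.castSucc_lt_succ))]
  exact hr s

theorem pairwise_disjoint_bitCylinder (j : Fin L) (v : unitInterval) (w : A.Seed) :
    Pairwise (Function.onFun Disjoint fun y : {s : Fin T // (s : ℕ) < A.grid.time j.castSucc} → Bool
      => A.bitCylinder v w y) := by
  intro y y' hne
  refine Set.disjoint_left.2 fun r hr hr' => hne (funext fun s => bitReward_injective ?_)
  -- For a fixed table the run does not involve the means, so dummy means serve.
  rw [← A.eq_of_mem_bitCylinder j (fun _ => 0) v w hr, A.eq_of_mem_bitCylinder j (fun _ => 0) v w hr']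

/-- Every reward table with entries in `{0, 1}` lies in a cylinder. -/
theorem exists_mem_bitCylinder (j : Fin L) (v : unitInterval) (w : A.Seed)
    {r : Fin T → Fin K → unitInterval} (hr : ∀ t k, ∃ b, r t k = bitReward b) :
    ∃ y : {s : Fin T // (s : ℕ) < A.grid.time j.castSucc} → Bool, r ∈ A.bitCylinder v w y := by
  choose b hb using hr
  let q : Fin K → unitInterval := fun _ => 0
  let y : {s : Fin T // (s : ℕ) < A.grid.time j.castSucc} → Bool :=
    -- The bits that the actual run collects; `key` shows that replaying them reproduces the run.
    fun s => b s.1 (A.arm (blurredCoins T q v) (w, r) s.1)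
  have key : ∀ t : Fin T, (t : ℕ) < A.grid.time j.succ →
      A.arm (blurredCoins T q v) (w, r) t = A.play (bitFeedback v y) w t := by
    intro t
    induction t using WellFoundedLT.induction with
    | ind t ih =>
      intro ht
      rw [arm, play]
      congr 1
      funext s
      have hs := s.2.lt_time j ht
      rw [← ih s.1 s.2.lt (lt_trans (Fin.lt_def.1 s.2.lt) ht)]
      simp only [CorruptedInstance.corrupted, bitFeedback, dif_pos hs]
      simp only [blurredCoins, y, hb]
  refine ⟨y, fun s => ?_⟩
  rw [← key s.1 (lt_trans s.2 (A.grid.strictMono j.castSucc_lt_succ)), hb]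

/-- The means of an instance with the single good arm `i`. -/
noncomputable def biasedMean (Δ : ℝ) (hΔ : Δ ∈ Set.Icc (0 : ℝ) (1 / 2)) (i k : Fin K) :
    unitInterval :=
  ⟨if k = i then 1 / 2 + Δ else 1 / 2, by
    obtain ⟨h₁, h₂⟩ := hΔ
    constructor <;> split_ifs <;> linarith⟩

/-- Once `y` is fixed so are the arms, and the cylinder is a product set with one coordinate
constraint per round before `τ`. Relative to a fair coin, gap `Δ` is bias `2Δ`. -/
theorem measureReal_bitCylinder {τ : ℕ} {Δ : ℝ} (hΔ : Δ ∈ Set.Icc (0 : ℝ) (1 / 2)) (i : Fin K)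
    (v : unitInterval) (w : A.Seed) (y : {s : Fin T // (s : ℕ) < τ} → Bool) :
    (Measure.pi fun _ : Fin T => (blurredCoins T (biasedMean Δ hΔ i) v).law).real
      (A.bitCylinder v w y) =
    (1 / 2 : ℝ) ^ Fintype.card {s : Fin T // (s : ℕ) < τ} *
      likelihood (fun y s => A.play (bitFeedback v y) w s.1) (2 * Δ) i y := by
  set S : Fin T → Set (Fin K → unitInterval) := fun s =>
    if h : (s : ℕ) < τ then
      {x | x (A.play (bitFeedback v y) w s) = bitReward (y ⟨s, h⟩)} else Set.univ with hS
  have hcyl : A.bitCylinder v w y = Set.univ.pi S := by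
    ext r
    simp only [bitCylinder, Set.mem_ofPred_eq, Set.mem_univ_pi, hS]
    constructor
    · intro h s
      split_ifs with hs
      · exact h ⟨s, hs⟩
      · trivial
    · intro h s
      have := h s.1
      rwa [dif_pos s.2] at this
  rw [hcyl, measureReal_def, Measure.pi_pi, ENNReal.toReal_prod]
  have hfac : ∀ s : {s : Fin T // (s : ℕ) < τ},
      ((blurredCoins T (biasedMean Δ hΔ i) v).law (S s.1)).toReal =
      1 / 2 * (1 + if A.play (bitFeedback v y) w s.1 = i then 2 * Δ * bitSign (y s) else 0) := by
    intro s
    have h := blurredCoins_law_real (T := T) (biasedMean Δ hΔ i) v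
      (A.play (bitFeedback v y) w s.1) (y s)
    rw [measureReal_def] at h
    simp only [hS, dif_pos s.2]
    rw [h]
    simp only [biasedMean, bitSign]
    split_ifs <;> ring
  rw [likelihood, ← Finset.card_univ, ← Finset.prod_const, ← Finset.prod_mul_distrib,
    ← Finset.prod_congr rfl fun s _ => hfac s]
  rw [← Finset.prod_subtype (Finset.univ.filter fun s : Fin T => (s : ℕ) < τ) (by simp)
    fun s => ((blurredCoins T (biasedMean Δ hΔ i) v).law (S s)).toReal]
  refine (Finset.prod_subset (Finset.filter_subset _ _) fun s _ hs => ?_).symm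
  have hs' : ¬ (s : ℕ) < τ := by simpa using hs
  simp [hS, hs']

/-- For a fixed seed, the good arm is seldom pulled on average over its position. -/
theorem sum_measureReal_arm_le (j : Fin L) {Δ : ℝ} (hΔ : Δ ∈ Set.Icc (0 : ℝ) (1 / 2))
    (hΔ' : (2 * Δ) ^ 2 ≤ 1 / 2) (v : unitInterval) (w : A.Seed) (t : Fin T)
    (ht : (t : ℕ) < A.grid.time j.succ) :
    ∑ i, (Measure.pi fun _ : Fin T => (blurredCoins T (biasedMean Δ hΔ i) v).law).real
      {r | A.arm (blurredCoins T (biasedMean Δ hΔ i) v) (w, r) t = i} ≤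
    1 + 8 * ((2 * Δ) ^ 2 * A.grid.time j.castSucc) + K / 8 := by
  set τ := A.grid.time j.castSucc with hτ
  have hcard : Fintype.card {s : Fin T // (s : ℕ) < τ} ≤ τ := by
    rw [Fintype.card_subtype, Fin.card_filter_val_lt]
    exact min_le_right _ _
  have hsum := sum_likelihood_le (W := {s : Fin T // (s : ℕ) < τ})
    (fun y s => A.play (bitFeedback v y) w s.1)
    (fun y s b => A.play_congr w s.1 fun u hu => by
      unfold bitFeedback
      split_ifs with h
      · rw [Function.update_of_ne]
        exact fun e => hu.ne (congrArg Subtype.val e)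
      · rfl)
    (fun y => A.play (bitFeedback v y) w t) hΔ' fun i => by
      simp only [← A.measureReal_bitCylinder hΔ i v w]
      -- The mass bound holds since distinct bit strings give disjoint cylinders of one probability
      -- space.
      rw [← measureReal_biUnion_finset
        (fun y _ y' _ h => A.pairwise_disjoint_bitCylinder j v w h)
        fun y _ => A.measurableSet_bitCylinder v w y]
      exact measureReal_le_one
  refine le_trans (Finset.sum_le_sum fun i _ => ?_) (hsum.trans ?_)
  · simp only [← A.measureReal_bitCylinder hΔ i v w]
    rw [← Finset.sum_filter]
    refine le_trans ?_ (measureReal_biUnion_finset_le _ _)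
    have hae : ∀ᵐ r ∂(Measure.pi fun _ : Fin T => (blurredCoins T (biasedMean Δ hΔ i) v).law),
        ∀ s k, ∃ b, r s k = bitReward b := by
      rw [ae_all_iff]
      intro s
      exact (measurePreserving_eval (fun _ : Fin T => (blurredCoins T (biasedMean Δ hΔ i) v).law)
        s).quasiMeasurePreserving.ae (ae_blurredCoins _ v)
    refine ENNReal.toReal_mono (measure_ne_top _ _) (measure_mono_ae ?_)
    filter_upwards [hae] with r hr hi
    obtain ⟨y, hy⟩ := A.exists_mem_bitCylinder j v w hr
    have := A.arm_eq_play_of_mem_bitCylinder j (biasedMean Δ hΔ i) v w y hy t ht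
    refine Set.mem_biUnion (x := y) ?_ hy
    exact Finset.mem_coe.2 (Finset.mem_filter.2 ⟨Finset.mem_univ _, this ▸ hi⟩)
  · gcongr

theorem exists_blurredCoins_regret (hK : 2 ≤ K) (j : Fin L) {Δ : ℝ}
    (hΔ : Δ ∈ Set.Icc (0 : ℝ) (1 / 16)) (hτ : 256 * (Δ ^ 2 * A.grid.time j.castSucc) ≤ K)
    (v : unitInterval) :
    ∃ p : Fin K → unitInterval, 1 / 4 * (Δ * A.grid.time j.succ) ≤
      A.regret (blurredCoins T p v) := by
  have hn : A.grid.time j.succ ≤ T := by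
    conv_rhs => rw [← A.grid.time_last]
    exact A.grid.strictMono.monotone (Fin.le_last _)
  have hΔ₁ : Δ ∈ Set.Icc (0 : ℝ) (1 / 2) := ⟨hΔ.1, hΔ.2.trans (by norm_num)⟩
  have hΔ₂ : (2 * Δ) ^ 2 ≤ 1 / 2 := by nlinarith [hΔ.1, hΔ.2]
  have hK' : (2 : ℝ) ≤ K := by exact_mod_cast hK
  suffices h : ∀ t : Fin T, (t : ℕ) < A.grid.time j.succ →
      ∑ i, (A.gameLaw (blurredCoins T (biasedMean Δ hΔ₁ i) v)).real
        {z | A.arm (blurredCoins T (biasedMean Δ hΔ₁ i) v) z t = i} ≤ (1 - 1 / 4) * K by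
    obtain ⟨i, hi⟩ := A.exists_regret_ge (by lia)
      (fun i => blurredCoins T (biasedMean Δ hΔ₁ i) v) hΔ.1
      (fun i k => CorruptedInstance.gap_of_mean _ i (m := 1 / 2) hΔ.1
        (fun k => blurredCoins_mean _ v k) k) hn h
    exact ⟨_, hi⟩
  intro t ht
  have hm : ∀ i, MeasurableSet {z | A.arm (blurredCoins T (biasedMean Δ hΔ₁ i) v) z t = i} :=
    fun i => A.measurable_arm _ t (measurableSet_singleton i)
  -- By Fubini, the bound for each fixed seed can be averaged over the seed.
  have e : ∀ i, (A.gameLaw (blurredCoins T (biasedMean Δ hΔ₁ i) v)).real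
      {z | A.arm (blurredCoins T (biasedMean Δ hΔ₁ i) v) z t = i} =
      ∫ w, (Measure.pi fun _ : Fin T => (blurredCoins T (biasedMean Δ hΔ₁ i) v).law).real
        {r | A.arm (blurredCoins T (biasedMean Δ hΔ₁ i) v) (w, r) t = i} ∂A.seedLaw :=
    fun i => by
      rw [measureReal_def, gameLaw, Measure.prod_apply (hm i)]
      exact (integral_toReal (measurable_measure_prodMk_left (hm i)).aemeasurable
        (Filter.Eventually.of_forall fun _ => measure_lt_top _ _)).symm
  have hint : ∀ i ∈ Finset.univ, Integrable (fun w =>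
      (Measure.pi fun _ : Fin T => (blurredCoins T (biasedMean Δ hΔ₁ i) v).law).real
        {r | A.arm (blurredCoins T (biasedMean Δ hΔ₁ i) v) (w, r) t = i}) A.seedLaw := by
    intro i _
    refine Integrable.of_bound
      (measurable_measure_prodMk_left (hm i)).ennreal_toReal.aestronglyMeasurable 1
      (Filter.Eventually.of_forall fun w => ?_)
    rw [Real.norm_of_nonneg measureReal_nonneg]
    exact measureReal_le_one
  simp only [e]
  rw [← integral_finsetSum _ hint]
  have hle := integral_mono (integrable_finsetSum _ hint)
    (integrable_const (1 + 8 * ((2 * Δ) ^ 2 * (A.grid.time j.castSucc : ℝ)) + K / 8))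
    fun w => A.sum_measureReal_arm_le j hΔ₁ hΔ₂ v w t ht
  rw [integral_const, probReal_univ, one_smul] at hle
  refine hle.trans ?_
  -- `1 ≤ K/2`, and `hτ` gives `32 Δ² t_j ≤ K/8`; with the remaining `K/8` the total is `3K/4`.
  linarith

end BatchedAlgorithm

/-! ### Some batch of the grid grows fast -/

/-- A grid cannot grow slower than `Φ` in all batches if the iterates `b` of `Φ` stay below the
horizon. -/
theorem StaticGrid.exists_le_time {T L : ℕ} (g : StaticGrid T L) (hL : 0 < L) (b : ℕ → ℝ)
    (Φ : ℝ → ℝ) (hΦ : Monotone Φ) (hb₀ : 0 ≤ b 0) (hb : ∀ m, b 0 ≤ b m)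
    (hbΦ : ∀ m, Φ (b m) ≤ b (m + 1)) (hT : b L ≤ T) :
    ∃ j : Fin L, Φ (max (g.time j.castSucc) (b 0)) ≤ g.time j.succ := by
  by_contra! h
  have step : ∀ j : Fin L, (g.time j.castSucc : ℝ) ≤ b j → (g.time j.succ : ℝ) < b (j + 1) :=
    fun j hj => (h j).trans_le ((hΦ (max_le hj (hb j))).trans (hbΦ j))
  have key : ∀ m : Fin (L + 1), (g.time m : ℝ) ≤ b m := by
    intro m
    induction m using Fin.induction with
    | zero => simpa [g.time_zero] using hb₀
    | succ j ih => simpa using (step j (by simpa using ih)).le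
  obtain ⟨n, rfl⟩ := Nat.exists_eq_succ_of_ne_zero hL.ne'
  -- Only the last batch needs the strict bound, which yields `T < b L`.
  have := step (Fin.last n) (by simpa using key (Fin.last n).castSucc)
  rw [Fin.succ_last, g.time_last] at this
  simp only [Fin.val_last] at this
  exact absurd hT (not_le.2 this)

theorem StaticGrid.exists_ratio_le {T L : ℕ} (g : StaticGrid T L) (hL : 0 < L) {C : ℝ}
    (hC : 0 < C) (hCT : C ≤ T) :
    ∃ j : Fin L, (T / C : ℝ) ^ (1 / (L : ℝ)) * max (g.time j.castSucc : ℝ) C ≤ g.time j.succ := by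
  have hTC : 1 ≤ (T / C : ℝ) := (one_le_div hC).2 hCT
  set ρ : ℝ := (T / C : ℝ) ^ (1 / (L : ℝ)) with hρ
  have hρ1 : 1 ≤ ρ := Real.one_le_rpow hTC (by positivity)
  have h := g.exists_le_time hL (fun m => ρ ^ m * C) (fun x => ρ * x)
    (fun x y hxy => mul_le_mul_of_nonneg_left hxy (by linarith)) (by simpa using hC.le)
    (fun m => by simpa using le_mul_of_one_le_left hC.le (one_le_pow₀ hρ1))
    (fun m => by rw [pow_succ]; linarith) ?_
  · simpa using h
  · rw [hρ, one_div, Real.rpow_inv_natCast_pow (by linarith) hL.ne', div_mul_cancel₀ _ hC.ne']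

/-- Starting from `K`, the iterates are `K ρ^e_m` with `e_0 = 0` and `e_{m+1} = 1 + e_m / 2`, that
is `e_m = 2 - 2^(1-m)`. The hypothesis on `K` says that the `L`-th iterate is at most `T`. -/
theorem StaticGrid.exists_sqrt_ratio_le {T L K : ℕ} (g : StaticGrid T L) (hL : 0 < L)
    (hT : 0 < T) (hK : 0 < K)
    (hKT : (K : ℝ) ≤ (T : ℝ) ^ (1 - (2 - (2 : ℝ) ^ (1 - (L : ℝ))) / (L : ℝ))) :
    ∃ j : Fin L, K * (T : ℝ) ^ (1 / (L : ℝ)) * √(max (g.time j.castSucc : ℝ) K / K) ≤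
      g.time j.succ := by
  have hT1 : (1 : ℝ) ≤ T := by exact_mod_cast hT
  have hK0 : (0 : ℝ) < K := by exact_mod_cast hK
  set ρ : ℝ := (T : ℝ) ^ (1 / (L : ℝ)) with hρ
  have hρ1 : 1 ≤ ρ := Real.one_le_rpow hT1 (by positivity)
  have hρ0 : 0 < ρ := by linarith
  have h := g.exists_le_time hL (fun m => K * ρ ^ (2 - (2 : ℝ) ^ (1 - (m : ℝ))))
    (fun x => K * ρ * √(x / K)) (fun x y hxy => by dsimp only; gcongr) (by positivity)
    (fun m => ?_) (fun m => ?_) ?_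
  · simpa using h
  · refine mul_le_mul_of_nonneg_left (Real.rpow_le_rpow_of_exponent_le hρ1 ?_) hK0.le
    have : (2 : ℝ) ^ (1 - (m : ℝ)) ≤ 2 ^ (1 - ((0 : ℕ) : ℝ)) :=
      Real.rpow_le_rpow_of_exponent_le (by norm_num) (by simp)
    linarith
  · refine le_of_eq ?_
    rw [mul_div_cancel_left₀ _ hK0.ne', Real.sqrt_eq_rpow, ← Real.rpow_mul hρ0.le, mul_assoc]
    nth_rewrite 1 [← Real.rpow_one ρ]
    rw [← Real.rpow_add hρ0]
    congr 2
    have : (2 : ℝ) ^ (1 - (m : ℝ)) = 2 * 2 ^ (1 - ((m + 1 : ℕ) : ℝ)) := by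
      nth_rewrite 2 [← Real.rpow_one 2]
      rw [← Real.rpow_add (by norm_num)]
      congr 1
      push_cast
      ring
    rw [this]
    ring
  · rw [hρ, ← Real.rpow_mul (by linarith)]
    calc (K : ℝ) * (T : ℝ) ^ (1 / (L : ℝ) * (2 - (2 : ℝ) ^ (1 - (L : ℝ))))
        ≤ (T : ℝ) ^ (1 - (2 - (2 : ℝ) ^ (1 - (L : ℝ))) / (L : ℝ)) *
          (T : ℝ) ^ (1 / (L : ℝ) * (2 - (2 : ℝ) ^ (1 - (L : ℝ)))) := by gcongr
      _ = T := by
        rw [← Real.rpow_add (by linarith)]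
        conv_rhs => rw [← Real.rpow_one (T : ℝ)]
        congr 1
        ring

/-! ### Choice of parameters and conclusion -/

namespace BatchedAlgorithm

variable {K T L : ℕ} (A : BatchedAlgorithm.{u} K T L)

/-- The part of the lower bound that is due to the corruption. -/
theorem exists_regret_ge_corruption (hK : 2 ≤ K) (hL : 0 < L) {C : ℝ} (hC : 0 < C) (hCT : C ≤ T) :
    ∃ I : CorruptedInstance K T, (∀ᵐ z ∂(A.gameLaw I), A.corruptionLevel I z = C) ∧
      1 / 2 * ((T : ℝ) ^ (1 / (L : ℝ)) * C ^ (1 - 1 / (L : ℝ))) ≤ A.regret I := by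
  obtain ⟨j, hj⟩ := A.grid.exists_ratio_le hL hC hCT
  set τ := A.grid.time j.castSucc with hτ
  have hτT : τ < T := by
    conv_rhs => rw [← A.grid.time_last]
    exact A.grid.strictMono (Fin.castSucc_lt_last j)
  have hτT' : (0 : ℝ) < T - τ := sub_pos.2 (by exact_mod_cast hτT)
  have hmax : 0 < max (τ : ℝ) C := lt_max_of_lt_right hC
  have hτ0 : (0 : ℝ) ≤ τ := Nat.cast_nonneg _
  let Δ : unitInterval := ⟨C / max (τ : ℝ) C, by positivity, (div_le_one hmax).2 (le_max_right _ _)⟩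
  -- Hiding costs `τ Δ ≤ C`; the rest of the budget is spread over the rounds from `τ` on, so that
  -- the level is exactly `C`. It fits because `C ≤ T`.
  have hv : (C - τ * Δ) / (T - τ) ∈ Set.Icc (0 : ℝ) 1 := by
    have hΔ : (Δ : ℝ) = C / max (τ : ℝ) C := rfl
    rcases le_total (τ : ℝ) C with h | h
    · rw [hΔ, max_eq_right h, div_self hC.ne', mul_one]
      exact ⟨div_nonneg (by linarith) hτT'.le, (div_le_one hτT').2 (by linarith)⟩
    · rw [hΔ, max_eq_left h, mul_div_cancel₀ _ (hC.trans_le h).ne']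
      simp
  let v : unitInterval := ⟨_, hv⟩
  obtain ⟨i, hi⟩ := A.exists_hiddenArm_regret hK j Δ v
  refine ⟨_, ?_, le_trans ?_ hi⟩
  · filter_upwards [A.hiddenArm_corruptionLevel hK i hτT.le Δ v] with z hz
    rw [hz]
    change τ * (Δ : ℝ) + (T - τ) * ((C - τ * Δ) / (T - τ)) = C
    rw [mul_div_cancel₀ _ hτT'.ne']
    ring
  · refine mul_le_mul_of_nonneg_left ?_ (by norm_num)
    have hΔ : (Δ : ℝ) = C / max (τ : ℝ) C := rfl
    calc (T : ℝ) ^ (1 / (L : ℝ)) * C ^ (1 - 1 / (L : ℝ))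
        = C * (T / C : ℝ) ^ (1 / (L : ℝ)) := by
          rw [Real.div_rpow (Nat.cast_nonneg _) hC.le, Real.rpow_sub hC, Real.rpow_one]
          ring
      _ = Δ * ((T / C : ℝ) ^ (1 / (L : ℝ)) * max (τ : ℝ) C) := by
          rw [hΔ]; field_simp
      _ ≤ Δ * A.grid.time j.succ := mul_le_mul_of_nonneg_left hj Δ.2.1

/-- The part of the lower bound that is due to the number of arms. -/
theorem exists_regret_ge_arms (hK : 2 ≤ K) (hL : 0 < L) (hT : 0 < T) {C : ℝ} (hC : 0 ≤ C)
    (hCT : C ≤ T)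
    (hKT : (K : ℝ) ≤ (T : ℝ) ^ (1 - (2 - (2 : ℝ) ^ (1 - (L : ℝ))) / (L : ℝ))) :
    ∃ I : CorruptedInstance K T, (∀ᵐ z ∂(A.gameLaw I), A.corruptionLevel I z = C) ∧
      1 / 64 * ((T : ℝ) ^ (1 / (L : ℝ)) * K) ≤ A.regret I := by
  obtain ⟨j, hj⟩ := A.grid.exists_sqrt_ratio_le hL hT (K := K) (by lia) hKT
  set τ := A.grid.time j.castSucc with hτ
  have hK0 : (0 : ℝ) < K := by exact_mod_cast (by lia : 0 < K)
  have hT0 : (0 : ℝ) < T := by exact_mod_cast hT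
  have hmax : 0 < max (τ : ℝ) K := lt_max_of_lt_right hK0
  set x : ℝ := √(max (τ : ℝ) K / K) with hx
  have hx0 : 0 < x := Real.sqrt_pos.2 (by positivity)
  have hx1 : 1 ≤ x := Real.one_le_sqrt.2 ((one_le_div hK0).2 (le_max_right _ _))
  have hxsq : x ^ 2 = max (τ : ℝ) K / K := Real.sq_sqrt (by positivity)
  have hxK : x ^ 2 * K = max (τ : ℝ) K := by rw [hxsq]; field_simp
  let v : unitInterval := ⟨C / T, by positivity, (div_le_one hT0).2 hCT⟩
  -- The factor `16` gives `256 Δ² τ = τ / x² ≤ K`, and `x ≥ 1` keeps `Δ ≤ 1/16`. In the regret the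
  -- factor `x` then cancels against the growth of the grid.
  obtain ⟨p, hp⟩ := A.exists_blurredCoins_regret hK j (Δ := 1 / (16 * x))
    ⟨by positivity, one_div_le_one_div_of_le (by norm_num) (by linarith)⟩ (by
      rw [← hτ]
      have : (τ : ℝ) ≤ x ^ 2 * K := hxK ▸ le_max_left _ _
      calc 256 * ((1 / (16 * x)) ^ 2 * (τ : ℝ)) = τ / x ^ 2 := by field_simp; norm_num
        _ ≤ (K : ℝ) := by rw [div_le_iff₀ (by positivity)]; linarith) v
  refine ⟨_, ?_, le_trans ?_ hp⟩
  · filter_upwards [A.blurredCoins_corruptionLevel (by lia) p v] with z hz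
    rw [hz]
    exact mul_div_cancel₀ C hT0.ne'
  · calc 1 / 64 * ((T : ℝ) ^ (1 / (L : ℝ)) * K)
        = 1 / 4 * (1 / (16 * x) * (K * (T : ℝ) ^ (1 / (L : ℝ)) * x)) := by
          field_simp; norm_num
      _ ≤ 1 / 4 * (1 / (16 * x) * A.grid.time j.succ) := by gcongr

end BatchedAlgorithm

theorem theorem4 :
    ∃ c : ℝ, 0 < c ∧
      ∀ (K T L : ℕ) (C : ℝ), 2 ≤ K → 2 ≤ L → 0 ≤ C → C ≤ (T : ℝ) →
        (K : ℝ) ≤ max ((T : ℝ) ^ (1 - (2 - (2 : ℝ) ^ (1 - (L : ℝ))) / (L : ℝ)))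
          (C ^ (1 - 1 / (L : ℝ))) →
        ∀ A : BatchedAlgorithm.{u} K T L,
          ∃ I : CorruptedInstance K T,
            (∀ᵐ z ∂(A.gameLaw I), A.corruptionLevel I z = C) ∧
            c * ((T : ℝ) ^ (1 / (L : ℝ)) * ((K : ℝ) + C ^ (1 - 1 / (L : ℝ)))) ≤ A.regret I := by
  -- Half of the smaller constant `1/64`, as the larger summand is at least half of the sum.
  refine ⟨1 / 128, by norm_num, fun K T L C hK hL hC hCT hKT A => ?_⟩
  have hT : 0 < T := by
    have h := A.grid.strictMono (show (0 : Fin (L + 1)) < Fin.last L by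
      rw [Fin.lt_def]; simp; lia)
    rwa [A.grid.time_zero, A.grid.time_last] at h
  have hK0 : (0 : ℝ) < K := by exact_mod_cast (by lia : 0 < K)
  have hρ : 0 ≤ (T : ℝ) ^ (1 / (L : ℝ)) := by positivity
  rcases le_or_gt (K : ℝ) (C ^ (1 - 1 / (L : ℝ))) with h | h
  · have hC0 : 0 < C := by
      refine hC.lt_of_ne' fun h0 => ?_
      -- For `L = 1` the power `0 ^ 0 = 1` would not exclude `C = 0` in this way.
      have hexp : 1 - 1 / (L : ℝ) ≠ 0 := by
        have : (1 : ℝ) < L := by exact_mod_cast (by lia : 1 < L)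
        have := (div_lt_one (by linarith)).2 this
        linarith
      rw [h0, Real.zero_rpow hexp] at h
      linarith
    obtain ⟨I, hI, hR⟩ := A.exists_regret_ge_corruption hK (by lia) hC0 hCT
    refine ⟨I, hI, le_trans ?_ hR⟩
    have := mul_le_mul_of_nonneg_left h hρ
    have := mul_nonneg hρ hK0.le
    linarith
  · obtain ⟨I, hI, hR⟩ := A.exists_regret_ge_arms hK (by lia) hT hC hCT
      ((le_max_iff.1 hKT).resolve_right (not_le.2 h))
    refine ⟨I, hI, le_trans ?_ hR⟩
    have := mul_le_mul_of_nonneg_left h.le hρ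
    linarith
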